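/- A permutation class is a set of permutations closed downward under containment; it is sum closed if it contains $\pi\oplus\sigma$ whenever it contains $\pi$ and $\sigma$, and finitely based if it is $\operatorname{Av}(B)$ for a finite antichain $B$ (its basis). A permutation is sum indecomposable if it is not a sum $\alpha\oplus\beta$ of two nonempty permutations. A sequence $(s_n)_{n\ge1}$ of nonnegative integers is realized by a class $\mathcal C$ if, for every $n\ge 1$, $\mathcal C$ contains exactly $s_n$ sum indecomposable permutations of length $n$; it is realizable if some class realizes it. The sequence is legal if $s_1\le 1$, $s_2\le 1$, $s_3\le 3$ and - for $n\ge1$: $s_n=0$ implies $s_{n+1}=0$; - for $n\ge3$: $s_n\le1$ implies $s_{n+1}\le1$; - for $n\ge4$: $s_n\le2$ implies $s_{n+1}\le2$; - for $n\ge5$: $s_n\le3$ implies $s_{n+1}\le3$. **Proposition.** Let $(s_n)$ be a legal sequence dominated termwise by $1,1,3,5,5,5,4,4,4,\dots$. Then $(s_n)$ is realizable. Moreover, it is realized by a finitely based, sum closed permutation class each of whose nonempty sum indecomposable members is either of one of the four forms ($k\ge0$, where $12\cdots k$ is empty for $k=0$) $$12\cdots k\ominus 1,\quad (21\oplus 12\cdots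 k)\ominus 1,\quad (1\oplus 21\oplus 12\cdots k)\ominus 1,\quad (12\oplus 21\oplus 12\cdots k)\ominus 1,$$ or one of the five permutations $312$, $3421$, $4321$, $(21\oplus21)\ominus1=32541$, $(123\oplus21)\ominus1=234651$. Here $\pi\ominus\sigma$ places $\sigma$ below and to the right of $\pi$. -/

import Mathlib

namespace PermClass

/-- A permutation of some length `n` (the empty permutation, `n = 0`, is included).
Positions and values are indexed from `0`. -/
abbrev Patt : Type := Σ n : ℕ, Equiv.Perm (Fin n)

/-- The length of a permutation. -/
def len (p : Patt) : ℕ := p.1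

/-- The one-line notation of a permutation, with values indexed from `1` as usual. -/
def oneLine (p : Patt) : List ℕ := List.ofFn fun i : Fin p.1 => (p.2 i : ℕ) + 1

/-- Containment order: `p` is contained in `q` if some subsequence of `q` is order isomorphic
to `p`. -/
def Contained (p q : Patt) : Prop :=
  ∃ f : Fin p.1 ↪o Fin q.1, ∀ i j : Fin p.1, p.2 i < p.2 j ↔ q.2 (f i) < q.2 (f j)

/-- The direct sum `p ⊕ q`: `q` is placed above and to the right of `p`. -/
def dsum (p q : Patt) : Patt :=
  ⟨p.1 + q.1, finSumFinEquiv.symm.trans ((Equiv.sumCongr p.2 q.2).trans finSumFinEquiv)⟩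

/-- The skew sum `p ⊖ q`: `q` is placed below and to the right of `p`. -/
def skew (p q : Patt) : Patt :=
  ⟨p.1 + q.1, finSumFinEquiv.symm.trans ((Equiv.sumCongr p.2 q.2).trans
    ((Equiv.sumComm (Fin p.1) (Fin q.1)).trans
      (finSumFinEquiv.trans (finCongr (Nat.add_comm q.1 p.1)))))⟩

/-- The permutation `p` is not the sum of two nonempty permutations. -/
def SumIndecomposable (p : Patt) : Prop :=
  ∀ a b : Patt, 1 ≤ len a → 1 ≤ len b → p ≠ dsum a b

/-- A permutation class: a set of permutations closed downward under containment. -/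
def IsPermClass (C : Set Patt) : Prop :=
  ∀ p q : Patt, Contained p q → q ∈ C → p ∈ C

/-- A class is sum closed if it contains the sum of any two of its members. -/
def SumClosed (C : Set Patt) : Prop :=
  ∀ p q : Patt, p ∈ C → q ∈ C → dsum p q ∈ C

/-- `Av B`: the permutations that avoid every member of `B`. -/
def Av (B : Set Patt) : Set Patt := {p | ∀ b ∈ B, ¬ Contained b p}

/-- `B` is the basis of `C`: an antichain with `C = Av B`. -/
def IsBasis (B C : Set Patt) : Prop := IsAntichain Contained B ∧ C = Av B

/-- A class is finitely based if its basis is finite. -/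
def FinitelyBased (C : Set Patt) : Prop := ∃ B : Set Patt, B.Finite ∧ IsBasis B C

/-- The class `C` has precisely `s n` sum indecomposable permutations of length `n`, for every
`n ≥ 1`. The value `s 0` plays no role. -/
def Realizes (C : Set Patt) (s : ℕ → ℕ) : Prop :=
  ∀ n : ℕ, 1 ≤ n →
    {π : Equiv.Perm (Fin n) | SumIndecomposable ⟨n, π⟩ ∧ (⟨n, π⟩ : Patt) ∈ C}.ncard = s n

/-- A sequence is realizable if some permutation class realizes it. -/
def Realizable (s : ℕ → ℕ) : Prop := ∃ C : Set Patt, IsPermClass C ∧ Realizes C s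

/-- Legal sequences `s 1, s 2, s 3, …`. -/
structure Legal (s : ℕ → ℕ) : Prop where
  one : s 1 ≤ 1
  two : s 2 ≤ 1
  three : s 3 ≤ 3
  zero_step : ∀ n : ℕ, 1 ≤ n → s n = 0 → s (n + 1) = 0
  one_step : ∀ n : ℕ, 3 ≤ n → s n ≤ 1 → s (n + 1) ≤ 1
  two_step : ∀ n : ℕ, 4 ≤ n → s n ≤ 2 → s (n + 1) ≤ 2
  three_step : ∀ n : ℕ, 5 ≤ n → s n ≤ 3 → s (n + 1) ≤ 3

/-- `t` dominates `s` (as sequences indexed by `n ≥ 1`). -/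
def DominatedBy (s t : ℕ → ℕ) : Prop := ∀ n : ℕ, 1 ≤ n → s n ≤ t n

/-- The sequence `1, 1, 3, 5, 5, 5, 4, 4, 4, …`, indexed from `1`. -/
def bound (n : ℕ) : ℕ :=
  if n ≤ 2 then 1 else if n = 3 then 3 else if n ≤ 6 then 5 else 4

/-- The increasing permutation `12⋯k` (empty for `k = 0`). -/
def inc (k : ℕ) : Patt := ⟨k, Equiv.refl (Fin k)⟩

/-- The permutation `21`. -/
def p21 : Patt := skew (inc 1) (inc 1)

/-- `12⋯k ⊖ 1`. -/
def chain1 (k : ℕ) : Patt := skew (inc k) (inc 1)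

/-- `(21 ⊕ 12⋯k) ⊖ 1`. -/
def chain2 (k : ℕ) : Patt := skew (dsum p21 (inc k)) (inc 1)

/-- `(1 ⊕ 21 ⊕ 12⋯k) ⊖ 1`. -/
def chain3 (k : ℕ) : Patt := skew (dsum (inc 1) (dsum p21 (inc k))) (inc 1)

/-- `(12 ⊕ 21 ⊕ 12⋯k) ⊖ 1`. -/
def chain4 (k : ℕ) : Patt := skew (dsum (inc 2) (dsum p21 (inc k))) (inc 1)

/-- The sporadic permutations `312`, `3421`, `4321`, `32541`, `234651`. -/
def Sporadic (p : Patt) : Prop :=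
  oneLine p = [3, 1, 2] ∨ oneLine p = [3, 4, 2, 1] ∨ oneLine p = [4, 3, 2, 1] ∨
    oneLine p = [3, 2, 5, 4, 1] ∨ oneLine p = [2, 3, 4, 6, 5, 1]

/-- The members of the four chains together with the five sporadic permutations. -/
def InConstruction (p : Patt) : Prop :=
  (∃ k : ℕ, p = chain1 k ∨ p = chain2 k ∨ p = chain3 k ∨ p = chain4 k) ∨ Sporadic p

end PermClass

namespace PermClass

/-! For each length `n`, take the first `s n` entries of a fixed priority list `candidates n`; call
the union D = `selection s`. The realizing class `sumClass D` consists of the permutations all of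
whose nonempty sum indecomposable patterns lie in D. It is sum closed because an indecomposable
pattern of a sum lies in one summand. Its nonempty indecomposables are exactly D once D contains
every nonempty indecomposable pattern of its members (`selection_downward`).

That closure is where legality enters. Contrapositively, `s n ≥ c + 1` forces `s m ≥ c + 1` for `c +
2 ≤ m ≤ n` (for `1 ≤ m ≤ n` when `c = 0`). The lists are ordered to match: `chain1` is always at
index 0, and `hump a` with `a ≤ 2` is at index `a + 1` in every length from `a + 3` on.
Indecomposable patterns of length at least 3 in a member of these chains belong to the same or
earlier chains. The sporadic permutations are checked by hand.

For the finite basis, a minimal nonmember is sum indecomposable. If it has at least two points, its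
inversion graph has a non-cut vertex, and deleting that point leaves a member of D. Members of D are
increasing up to 6 points, so basis elements are increasing up to 7. Such permutations are encoded
by a finite skeleton and a word over a finite alphabet, so Higman's lemma excludes infinite
antichains. -/

/-! ### Order isomorphism and containment -/

/-- Every injective word is order isomorphic to a permutation. -/
theorem exists_perm_orderIso {m : ℕ} {α : Type*} [LinearOrder α] (g : Fin m → α)
    (hg : Function.Injective g) :
    ∃ π : Equiv.Perm (Fin m), ∀ i j, π i < π j ↔ g i < g j := by
  have hs : StrictMono (g ∘ Tuple.sort g) :=
    (Tuple.monotone_sort g).strictMono_of_injective (hg.comp (Tuple.sort g).injective)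
  refine ⟨(Tuple.sort g).symm, fun i j => ?_⟩
  rw [← hs.lt_iff_lt]
  simp

/-- A permutation is determined by the relative order of its entries. -/
theorem perm_ext_of_lt_iff {n : ℕ} {π σ : Equiv.Perm (Fin n)}
    (h : ∀ i j, π i < π j ↔ σ i < σ j) : π = σ := by
  have hs : StrictMono (π.symm.trans σ) := fun i j hij => by
    have := (h (π.symm i) (π.symm j)).1 (by simpa using hij)
    simpa using this
  let e : Fin n ≃o Fin n := hs.orderIsoOfSurjective _ (π.symm.trans σ).surjective
  have he : e = OrderIso.refl _ := Subsingleton.elim _ _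
  ext i
  have := congrArg (fun f : Fin n ≃o Fin n => f (π i)) he
  simp [e] at this
  rw [this]

/-- Turns equality of permutations whose lengths agree only propositionally into equality of lists,
with no casts. -/
theorem oneLine_injective : Function.Injective oneLine := by
  rintro ⟨n, π⟩ ⟨m, σ⟩ h
  have hl := congrArg List.length h
  simp only [oneLine, List.length_ofFn] at hl
  subst hl
  simp only [oneLine, List.ofFn_inj] at h
  congr 1
  ext i
  simpa using congrFun h i

theorem length_oneLine (p : Patt) : (oneLine p).length = len p := by simp [oneLine, len]

@[simp] theorem len_dsum (p q : Patt) : len (dsum p q) = len p + len q := rfl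

@[simp] theorem len_skew (p q : Patt) : len (skew p q) = len p + len q := rfl

@[simp] theorem len_inc (k : ℕ) : len (inc k) = k := rfl

/-- The direct sum of permutations of fixed lengths. -/
def sumPerm {m l : ℕ} (a : Equiv.Perm (Fin m)) (b : Equiv.Perm (Fin l)) :
    Equiv.Perm (Fin (m + l)) :=
  (dsum ⟨m, a⟩ ⟨l, b⟩).2

/-- The skew sum of permutations of fixed lengths. -/
def skewPerm {m l : ℕ} (a : Equiv.Perm (Fin m)) (b : Equiv.Perm (Fin l)) :
    Equiv.Perm (Fin (m + l)) :=
  (skew ⟨m, a⟩ ⟨l, b⟩).2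

theorem dsum_mk {m l : ℕ} (a : Equiv.Perm (Fin m)) (b : Equiv.Perm (Fin l)) :
    dsum ⟨m, a⟩ ⟨l, b⟩ = ⟨m + l, sumPerm a b⟩ := rfl

theorem skew_mk {m l : ℕ} (a : Equiv.Perm (Fin m)) (b : Equiv.Perm (Fin l)) :
    skew ⟨m, a⟩ ⟨l, b⟩ = ⟨m + l, skewPerm a b⟩ := rfl

theorem contained_mk {m n : ℕ} {a : Equiv.Perm (Fin m)} {b : Equiv.Perm (Fin n)} :
    Contained ⟨m, a⟩ ⟨n, b⟩ ↔
      ∃ f : Fin m ↪o Fin n, ∀ i j : Fin m, a i < a j ↔ b (f i) < b (f j) := Iff.rfl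

theorem len_mk {n : ℕ} (a : Equiv.Perm (Fin n)) : len ⟨n, a⟩ = n := rfl

section

variable {m l : ℕ} (a : Equiv.Perm (Fin m)) (b : Equiv.Perm (Fin l))

theorem sumPerm_castAdd (i : Fin m) : (sumPerm a b (Fin.castAdd l i) : ℕ) = a i := by
  change (finSumFinEquiv (Sum.map a b (finSumFinEquiv.symm (Fin.castAdd l i))) : ℕ) = a i
  simp

theorem sumPerm_natAdd (i : Fin l) : (sumPerm a b (Fin.natAdd m i) : ℕ) = m + b i := by
  change (finSumFinEquiv (Sum.map a b (finSumFinEquiv.symm (Fin.natAdd m i))) : ℕ) = m + b i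
  simp

theorem skewPerm_castAdd (i : Fin m) : (skewPerm a b (Fin.castAdd l i) : ℕ) = l + a i := by
  change (finSumFinEquiv (Sum.map a b (finSumFinEquiv.symm (Fin.castAdd l i))).swap : ℕ)
    = l + a i
  simp

theorem skewPerm_natAdd (i : Fin l) : (skewPerm a b (Fin.natAdd m i) : ℕ) = b i := by
  change (finSumFinEquiv (Sum.map a b (finSumFinEquiv.symm (Fin.natAdd m i))).swap : ℕ) = b i
  simp

end

theorem oneLine_dsum (p q : Patt) :
    oneLine (dsum p q) = oneLine p ++ (oneLine q).map (len p + ·) := by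
  obtain ⟨m, a⟩ := p
  obtain ⟨l, b⟩ := q
  have h : oneLine (dsum ⟨m, a⟩ ⟨l, b⟩) = List.ofFn fun i => (sumPerm a b i : ℕ) + 1 := rfl
  have h' : (List.ofFn fun i => (sumPerm a b i : ℕ) + 1)
      = List.ofFn (Fin.append (fun i => (a i : ℕ) + 1) fun i => m + ((b i : ℕ) + 1)) := by
    congr 1
    ext i
    refine Fin.addCases (fun i => ?_) (fun i => ?_) i
    · rw [sumPerm_castAdd, Fin.append_left]
    · rw [sumPerm_natAdd, Fin.append_right, add_assoc]
  rw [h, h', List.ofFn_fin_append]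
  simp only [oneLine, List.map_ofFn, len_mk]
  rfl

theorem oneLine_skew (p q : Patt) :
    oneLine (skew p q) = (oneLine p).map (len q + ·) ++ oneLine q := by
  obtain ⟨m, a⟩ := p
  obtain ⟨l, b⟩ := q
  have h : oneLine (skew ⟨m, a⟩ ⟨l, b⟩) = List.ofFn fun i => (skewPerm a b i : ℕ) + 1 := rfl
  have h' : (List.ofFn fun i => (skewPerm a b i : ℕ) + 1)
      = List.ofFn (Fin.append (fun i => l + ((a i : ℕ) + 1)) fun i => (b i : ℕ) + 1) := by
    congr 1
    ext i
    refine Fin.addCases (fun i => ?_) (fun i => ?_) i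
    · rw [skewPerm_castAdd, Fin.append_left, add_assoc]
    · rw [skewPerm_natAdd, Fin.append_right]
  rw [h, h', List.ofFn_fin_append]
  simp only [oneLine, List.map_ofFn, len_mk]
  rfl

theorem oneLine_inc (k : ℕ) : oneLine (inc k) = List.range' 1 k := by
  have h : oneLine (inc k) = List.ofFn fun i : Fin k => (i : ℕ) + 1 := rfl
  rw [h]
  apply List.ext_getElem <;> simp [add_comm]

theorem oneLine_eq_nil {p : Patt} (h : len p = 0) : oneLine p = [] := by
  rw [← List.length_eq_zero_iff, length_oneLine, h]

theorem dsum_eq_left (p : Patt) {q : Patt} (h : len q = 0) : dsum p q = p :=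
  oneLine_injective (by simp [oneLine_dsum, oneLine_eq_nil h])

theorem dsum_eq_right {p : Patt} (q : Patt) (h : len p = 0) : dsum p q = q :=
  oneLine_injective (by simp [oneLine_dsum, oneLine_eq_nil h, h])

theorem skew_eq_left (p : Patt) {q : Patt} (h : len q = 0) : skew p q = p :=
  oneLine_injective (by simp [oneLine_skew, oneLine_eq_nil h, h])

theorem skew_eq_right {p : Patt} (q : Patt) (h : len p = 0) : skew p q = q :=
  oneLine_injective (by simp [oneLine_skew, oneLine_eq_nil h])

theorem dsum_inc_inc (a b : ℕ) : dsum (inc a) (inc b) = inc (a + b) :=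
  oneLine_injective (by
    simp [oneLine_dsum, oneLine_inc, List.map_add_range', ← List.range'_append_1, add_comm])

/-! ### Containment in sums and skew sums -/

theorem Contained.refl (p : Patt) : Contained p p := ⟨RelEmbedding.refl _, fun _ _ => Iff.rfl⟩

theorem Contained.trans {p q r : Patt} (h₁ : Contained p q) (h₂ : Contained q r) :
    Contained p r := by
  obtain ⟨f, hf⟩ := h₁
  obtain ⟨g, hg⟩ := h₂
  exact ⟨f.trans g, fun i j => (hf i j).trans (hg _ _)⟩

theorem Contained.len_le {p q : Patt} (h : Contained p q) : len p ≤ len q := by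
  obtain ⟨f, -⟩ := h
  have h := Fintype.card_le_of_embedding f.toEmbedding
  rwa [Fintype.card_fin, Fintype.card_fin] at h

/-- The only order embedding of `Fin n` into itself is the identity. -/
theorem Contained.eq_of_len_le {p q : Patt} (h : Contained p q) (hl : len q ≤ len p) :
    p = q := by
  have hl' := h.len_le.antisymm hl
  obtain ⟨n, π⟩ := p
  obtain ⟨m, σ⟩ := q
  obtain ⟨f, hf⟩ := h
  simp only [len] at hl'
  subst hl'
  congr 1
  apply perm_ext_of_lt_iff
  let e : Fin n ≃o Fin n :=
    f.strictMono.orderIsoOfSurjective _ (Finite.surjective_of_injective f.injective)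
  have he : ∀ i, f i = i := fun i => by
    have := congrArg (fun g : Fin n ≃o Fin n => g i)
      (Subsingleton.elim e (OrderIso.refl _))
    simpa [e] using this
  intro i j
  rw [hf i j, he, he]

theorem Contained.of_forall_le {p q : Patt} (f : Fin p.1 → Fin q.1)
    (hf : ∀ i j, i < j → f i < f j) (h : ∀ i j, p.2 i < p.2 j → q.2 (f i) < q.2 (f j)) :
    Contained p q := by
  refine ⟨OrderEmbedding.ofStrictMono f hf, fun i j => ⟨h i j, fun hij => ?_⟩⟩
  by_contra hn
  rcases (not_lt.1 hn).lt_or_eq with hlt | heq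
  · exact lt_asymm hij (h _ _ hlt)
  · rw [p.2.injective heq] at hij
    exact lt_irrefl _ hij

theorem contained_dsum_right (p q : Patt) : Contained q (dsum p q) := by
  obtain ⟨m, a⟩ := p
  obtain ⟨l, b⟩ := q
  rw [dsum_mk]
  refine .of_forall_le (Fin.natAdd m) (fun _ _ h => Nat.add_lt_add_left h m) fun i j h => ?_
  change sumPerm a b (Fin.natAdd m i) < sumPerm a b (Fin.natAdd m j)
  rw [Fin.lt_def, sumPerm_natAdd, sumPerm_natAdd]
  exact Nat.add_lt_add_left h m

theorem contained_skew_left (p q : Patt) : Contained p (skew p q) := by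
  obtain ⟨m, a⟩ := p
  obtain ⟨l, b⟩ := q
  rw [skew_mk]
  refine .of_forall_le (Fin.castAdd l) (fun _ _ h => h) fun i j h => ?_
  change skewPerm a b (Fin.castAdd l i) < skewPerm a b (Fin.castAdd l j)
  rw [Fin.lt_def, skewPerm_castAdd, skewPerm_castAdd]
  exact Nat.add_lt_add_left h l

theorem exists_pattern {m n : ℕ} (π : Equiv.Perm (Fin n)) (f : Fin m → Fin n)
    (hf : StrictMono f) :
    ∃ a : Equiv.Perm (Fin m), Contained ⟨m, a⟩ ⟨n, π⟩ ∧
      ∀ i j, a i < a j ↔ π (f i) < π (f j) := by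
  obtain ⟨a, ha⟩ := exists_perm_orderIso (fun i => π (f i)) (π.injective.comp hf.injective)
  exact ⟨a, ⟨OrderEmbedding.ofStrictMono f hf, ha⟩, ha⟩

/-- The number of entries of a strictly increasing sequence below a threshold. -/
theorem exists_threshold {n N : ℕ} (f : Fin n → Fin N) (hf : StrictMono f) (c : ℕ) :
    ∃ m l, m + l = n ∧ ∀ i : Fin n, (f i : ℕ) < c ↔ (i : ℕ) < m := by
  induction n with
  | zero => exact ⟨0, 0, rfl, fun i => i.elim0⟩
  | succ n ih =>
    obtain ⟨m, l, hml, h⟩ := ih (fun i => f i.castSucc) (fun i j hij => hf hij)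
    by_cases hc : (f (Fin.last n) : ℕ) < c
    · refine ⟨n + 1, 0, rfl, fun i => ⟨fun _ => i.2, fun _ => lt_of_le_of_lt ?_ hc⟩⟩
      exact hf.monotone (Fin.le_last i)
    · refine ⟨m, l + 1, by omega, fun i => ?_⟩
      induction i using Fin.lastCases with
      | last => simp only [hc, Fin.val_last, false_iff]; omega
      | cast i => simpa using h i

/-- A permutation split by a threshold such that all entries of the first part are below those of
the second is a sum. -/
theorem eq_dsum_of_forall_lt {m l : ℕ} (ρ : Equiv.Perm (Fin (m + l)))
    (a : Equiv.Perm (Fin m)) (b : Equiv.Perm (Fin l))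
    (h : ∀ i j, ρ (Fin.castAdd l i) < ρ (Fin.natAdd m j))
    (ha : ∀ i j, a i < a j ↔ ρ (Fin.castAdd l i) < ρ (Fin.castAdd l j))
    (hb : ∀ i j, b i < b j ↔ ρ (Fin.natAdd m i) < ρ (Fin.natAdd m j)) :
    (⟨m + l, ρ⟩ : Patt) = dsum ⟨m, a⟩ ⟨l, b⟩ := by
  rw [dsum_mk]
  congr 1
  have aux : ∀ i j, sumPerm a b (Fin.castAdd l i) < sumPerm a b (Fin.natAdd m j) := by
    intro i j
    have hi := (a i).2
    have hj := (b j).2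
    rw [Fin.lt_def, sumPerm_castAdd, sumPerm_natAdd]
    omega
  refine perm_ext_of_lt_iff fun i j => ?_
  refine Fin.addCases (fun i => ?_) (fun i => ?_) i <;>
    refine Fin.addCases (fun j => ?_) (fun j => ?_) j
  · rw [← ha, Fin.lt_def, Fin.lt_def, sumPerm_castAdd, sumPerm_castAdd]
  · exact iff_of_true (h i j) (aux i j)
  · exact iff_of_false (h j i).asymm (aux j i).asymm
  · rw [← hb, Fin.lt_def, Fin.lt_def, sumPerm_natAdd, sumPerm_natAdd]
    rw [Nat.add_lt_add_iff_left]

/-- A permutation split by a threshold such that all entries of the first part are above those of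
the second is a skew sum. -/
theorem eq_skew_of_forall_lt {m l : ℕ} (ρ : Equiv.Perm (Fin (m + l)))
    (a : Equiv.Perm (Fin m)) (b : Equiv.Perm (Fin l))
    (h : ∀ i j, ρ (Fin.natAdd m j) < ρ (Fin.castAdd l i))
    (ha : ∀ i j, a i < a j ↔ ρ (Fin.castAdd l i) < ρ (Fin.castAdd l j))
    (hb : ∀ i j, b i < b j ↔ ρ (Fin.natAdd m i) < ρ (Fin.natAdd m j)) :
    (⟨m + l, ρ⟩ : Patt) = skew ⟨m, a⟩ ⟨l, b⟩ := by
  rw [skew_mk]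
  congr 1
  have aux : ∀ i j, skewPerm a b (Fin.natAdd m j) < skewPerm a b (Fin.castAdd l i) := by
    intro i j
    have hi := (a i).2
    have hj := (b j).2
    rw [Fin.lt_def, skewPerm_castAdd, skewPerm_natAdd]
    omega
  refine perm_ext_of_lt_iff fun i j => ?_
  refine Fin.addCases (fun i => ?_) (fun i => ?_) i <;>
    refine Fin.addCases (fun j => ?_) (fun j => ?_) j
  · rw [← ha, Fin.lt_def, Fin.lt_def, skewPerm_castAdd, skewPerm_castAdd]
    rw [Nat.add_lt_add_iff_left]
  · exact iff_of_false (h i j).asymm (aux i j).asymm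
  · exact iff_of_true (h j i) (aux j i)
  · rw [← hb, Fin.lt_def, Fin.lt_def, skewPerm_natAdd, skewPerm_natAdd]

/-- A strictly increasing map into a concatenation of two intervals is a concatenation. -/
theorem exists_split {n P Q : ℕ} (f : Fin n → Fin (P + Q)) (hf : StrictMono f) :
    ∃ (m l : ℕ) (h : m + l = n) (g : Fin m → Fin P) (k : Fin l → Fin Q),
      StrictMono g ∧ StrictMono k ∧
      (∀ i, f (Fin.cast h (Fin.castAdd l i)) = Fin.castAdd Q (g i)) ∧
      ∀ i, f (Fin.cast h (Fin.natAdd m i)) = Fin.natAdd P (k i) := by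
  obtain ⟨m, l, rfl, hm⟩ := exists_threshold f hf P
  have h1 : ∀ i : Fin m, ∃ x : Fin P, f (Fin.castAdd l i) = Fin.castAdd Q x := fun i =>
    ⟨⟨f (Fin.castAdd l i), (hm _).2 i.2⟩, rfl⟩
  have h2 : ∀ i : Fin l, ∃ x : Fin Q, f (Fin.natAdd m i) = Fin.natAdd P x := fun i => by
    have h0 : ¬ (f (Fin.natAdd m i) : ℕ) < P := by rw [hm]; simp
    have h0' : (f (Fin.natAdd m i) : ℕ) < P + Q := (f (Fin.natAdd m i)).2
    refine ⟨⟨f (Fin.natAdd m i) - P, by omega⟩, Fin.ext ?_⟩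
    simp only [Fin.val_natAdd]; omega
  choose g hg using h1
  choose k hk using h2
  refine ⟨m, l, rfl, g, k, fun i j hij => ?_, fun i j hij => ?_, hg, hk⟩
  · have := hf (show Fin.castAdd l i < Fin.castAdd l j from hij)
    rwa [hg, hg] at this
  · have := hf (show Fin.natAdd m i < Fin.natAdd m j from Nat.add_lt_add_left hij m)
    rw [hk, hk, Fin.lt_def] at this
    exact Nat.lt_of_add_lt_add_left this

/-- Embeddings increase positions, so the entries of `r` landing in `p` form an initial segment;
either part may be empty. -/
theorem Contained.exists_eq_dsum {r p q : Patt} (h : Contained r (dsum p q)) :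
    ∃ p' q', Contained p' p ∧ Contained q' q ∧ r = dsum p' q' := by
  obtain ⟨n, ρ⟩ := r
  obtain ⟨P, π⟩ := p
  obtain ⟨Q, σ⟩ := q
  rw [dsum_mk, contained_mk] at h
  obtain ⟨f, hf⟩ := h
  obtain ⟨m, l, rfl, g, k, hgm, hkm, hg, hk⟩ := exists_split f f.strictMono
  replace hg : ∀ i, f (Fin.castAdd l i) = Fin.castAdd Q (g i) := hg
  replace hk : ∀ i, f (Fin.natAdd m i) = Fin.natAdd P (k i) := hk
  obtain ⟨a, hac, ha⟩ := exists_pattern π g hgm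
  obtain ⟨b, hbc, hb⟩ := exists_pattern σ k hkm
  refine ⟨_, _, hac, hbc, eq_dsum_of_forall_lt ρ a b (fun i j => ?_) (fun i j => ?_)
    fun i j => ?_⟩
  · rw [hf, hg, hk, Fin.lt_def, sumPerm_castAdd, sumPerm_natAdd]
    have hi := (π (g i)).2
    have hj := (σ (k j)).2
    omega
  · rw [ha, hf, hg, hg, Fin.lt_def, Fin.lt_def, sumPerm_castAdd, sumPerm_castAdd]
  · rw [hb, hf, hk, hk, Fin.lt_def, Fin.lt_def, sumPerm_natAdd, sumPerm_natAdd]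
    omega

theorem Contained.exists_eq_skew {r p q : Patt} (h : Contained r (skew p q)) :
    ∃ p' q', Contained p' p ∧ Contained q' q ∧ r = skew p' q' := by
  obtain ⟨n, ρ⟩ := r
  obtain ⟨P, π⟩ := p
  obtain ⟨Q, σ⟩ := q
  rw [skew_mk, contained_mk] at h
  obtain ⟨f, hf⟩ := h
  obtain ⟨m, l, rfl, g, k, hgm, hkm, hg, hk⟩ := exists_split f f.strictMono
  replace hg : ∀ i, f (Fin.castAdd l i) = Fin.castAdd Q (g i) := hg
  replace hk : ∀ i, f (Fin.natAdd m i) = Fin.natAdd P (k i) := hk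
  obtain ⟨a, hac, ha⟩ := exists_pattern π g hgm
  obtain ⟨b, hbc, hb⟩ := exists_pattern σ k hkm
  refine ⟨_, _, hac, hbc, eq_skew_of_forall_lt ρ a b (fun i j => ?_) (fun i j => ?_)
    fun i j => ?_⟩
  · rw [hf, hg, hk, Fin.lt_def, skewPerm_castAdd, skewPerm_natAdd]
    have hi := (π (g i)).2
    have hj := (σ (k j)).2
    omega
  · rw [ha, hf, hg, hg, Fin.lt_def, Fin.lt_def, skewPerm_castAdd, skewPerm_castAdd]
    omega
  · rw [hb, hf, hk, hk, Fin.lt_def, Fin.lt_def, skewPerm_natAdd, skewPerm_natAdd]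

theorem Contained.exists_eq_inc {r : Patt} {k : ℕ} (h : Contained r (inc k)) :
    ∃ l ≤ k, r = inc l := by
  have hl := h.len_le
  obtain ⟨n, ρ⟩ := r
  obtain ⟨f, hf⟩ := h
  refine ⟨n, hl, Sigma.ext rfl (heq_of_eq (perm_ext_of_lt_iff fun i j => ?_))⟩
  rw [hf]
  exact f.lt_iff_lt

/-- The values on either side of a cut are separated in a decomposable permutation. -/
theorem exists_inversion_of_cut {n : ℕ} {π : Equiv.Perm (Fin n)}
    (h : SumIndecomposable ⟨n, π⟩) {m : ℕ} (h0 : 0 < m) (hm : m < n) :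
    ∃ i j : Fin n, (i : ℕ) < m ∧ m ≤ j ∧ π j < π i := by
  by_contra! hc
  obtain ⟨l, rfl⟩ : ∃ l, n = m + (l + 1) := ⟨n - m - 1, by omega⟩
  obtain ⟨a, -, ha⟩ := exists_pattern π (fun i : Fin m => Fin.castAdd (l + 1) i) (fun _ _ h => h)
  obtain ⟨b, -, hb⟩ := exists_pattern π (fun i : Fin (l + 1) => Fin.natAdd m i)
    (fun _ _ h => Nat.add_lt_add_left h m)
  refine h ⟨m, a⟩ ⟨l + 1, b⟩ h0 (by simp [len])
    (eq_dsum_of_forall_lt π a b (fun i j => ?_) ha hb)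
  refine lt_of_le_of_ne (hc _ _ (by simp) (by simp)) fun he => ?_
  have := congrArg Fin.val (π.injective he)
  simp only [Fin.val_castAdd, Fin.val_natAdd] at this
  omega

/-- In a sum, no inversion crosses the cut between the summands. -/
theorem sumIndecomposable_of_forall_cut {n : ℕ} {π : Equiv.Perm (Fin n)}
    (h : ∀ m, 0 < m → m < n → ∃ i j : Fin n, (i : ℕ) < m ∧ m ≤ j ∧ π j < π i) :
    SumIndecomposable ⟨n, π⟩ := by
  rintro ⟨m, a⟩ ⟨l, b⟩ h1 h2 he
  rw [dsum_mk] at he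
  obtain rfl : n = m + l := congrArg len he
  obtain rfl : π = sumPerm a b := eq_of_heq (Sigma.mk.inj he).2
  rw [len_mk] at h1 h2
  obtain ⟨i, j, hi, hj, hij⟩ := h m (by omega) (by omega)
  have hj2 := j.2
  have e1 := sumPerm_castAdd a b ⟨i, hi⟩
  have e2 := sumPerm_natAdd a b ⟨j - m, by omega⟩
  have hi' : Fin.castAdd l ⟨i, hi⟩ = i := rfl
  have hj' : Fin.natAdd m (⟨j - m, by omega⟩ : Fin l) = j :=
    Fin.ext (by simp only [Fin.val_natAdd]; omega)
  rw [hi'] at e1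
  rw [hj'] at e2
  rw [Fin.lt_def, e1, e2] at hij
  have := (a ⟨i, hi⟩).2
  omega

theorem SumIndecomposable.of_len_le_one {p : Patt} (h : len p ≤ 1) : SumIndecomposable p := by
  rintro a b ha hb rfl
  simp at h
  omega

theorem sumIndecomposable_skew {p q : Patt} (hp : 1 ≤ len p) (hq : 1 ≤ len q) :
    SumIndecomposable (skew p q) := by
  obtain ⟨m, a⟩ := p
  obtain ⟨l, b⟩ := q
  rw [len_mk] at hp hq
  rw [skew_mk]
  refine sumIndecomposable_of_forall_cut fun n h0 hn => ?_
  -- The first and last entries form an inversion that crosses every cut.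
  refine ⟨Fin.castAdd l ⟨0, hp⟩, Fin.natAdd m ⟨l - 1, by omega⟩, h0, ?_, ?_⟩
  · simp only [Fin.val_natAdd]; omega
  · rw [Fin.lt_def, skewPerm_castAdd, skewPerm_natAdd]
    have := (b ⟨l - 1, by omega⟩).2
    omega

theorem SumIndecomposable.contained_dsum {r p q : Patt} (hr : SumIndecomposable r)
    (h : Contained r (dsum p q)) : Contained r p ∨ Contained r q := by
  obtain ⟨p', q', hp, hq, rfl⟩ := h.exists_eq_dsum
  rcases Nat.eq_zero_or_pos (len p') with h0 | h0
  · right; rwa [dsum_eq_right _ h0]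
  rcases Nat.eq_zero_or_pos (len q') with h1 | h1
  · left; rwa [dsum_eq_left _ h1]
  exact absurd rfl (hr p' q' h0 h1)

/-! ### Finite basis -/

/-- Words over a finite alphabet are well-quasi-ordered by the subword relation. -/
theorem wellQuasiOrdered_sublist {α : Type*} [Finite α] :
    WellQuasiOrdered (List.Sublist : List α → List α → Prop) := by
  -- Higman's lemma, with equality as the order on letters.
  have h := Set.PartiallyWellOrderedOn.partiallyWellOrderedOn_sublistForall₂ (α := α) (· = ·)
    (s := Set.univ) Set.finite_univ.partiallyWellOrderedOn
  intro f
  obtain ⟨m, n, hmn, hs⟩ := h (fun n => ⟨f n, by simp⟩)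
  refine ⟨m, n, hmn, ?_⟩
  simpa [Subrel, List.sublistForall₂_iff] using hs

/-- The relative positions of a point against `m` special points. -/
def pointLabel {m n : ℕ} (π : Equiv.Perm (Fin n)) (e : Fin m → Fin n) (x : Fin n) :
    (Fin m → Prop) × (Fin m → Prop) :=
  (fun s => e s < x, fun s => π (e s) < π x)

/-- The relative order of the special points. -/
def skeleton {m n : ℕ} (π : Equiv.Perm (Fin n)) (e : Fin m → Fin n) :
    Fin m → Fin m → Prop × Prop :=
  fun s s' => (e s < e s', π (e s) < π (e s'))

/-- Send special points to special points and the increasing points along the subword embedding.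
Equal skeletons preserve order among special points, equal labels preserve it between special and
increasing points, and monotonicity handles the increasing points. -/
theorem contained_of_sublist_labels {m t t' n n' : ℕ} {π : Equiv.Perm (Fin n)}
    {π' : Equiv.Perm (Fin n')} {e : Fin m → Fin n} {e' : Fin m → Fin n'}
    {u : Fin t → Fin n} {u' : Fin t' → Fin n'}
    (hu : StrictMono u) (hπu : StrictMono (π ∘ u)) (hu' : StrictMono u')
    (hπu' : StrictMono (π' ∘ u')) (he : Function.Bijective (Sum.elim e u))
    (he' : Function.Injective (Sum.elim e' u'))
    (hs : skeleton π e = skeleton π' e')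
    (hl : (List.ofFn fun i => pointLabel π e (u i)).Sublist
      (List.ofFn fun i => pointLabel π' e' (u' i))) :
    Contained ⟨n, π⟩ ⟨n', π'⟩ := by
  obtain ⟨g, hg⟩ : ∃ g : Fin t → Fin t', StrictMono g ∧
      ∀ i, pointLabel π e (u i) = pointLabel π' e' (u' (g i)) := by
    obtain ⟨f, hf⟩ := List.sublist_iff_exists_fin_orderEmbedding_get_eq.1 hl
    refine ⟨fun i => Fin.cast (by simp) (f (Fin.cast (by simp) i)), fun i j hij => ?_,
      fun i => ?_⟩
    · exact f.strictMono (by simpa using hij)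
    · have := hf (Fin.cast (by simp) i)
      rw [List.get_ofFn, List.get_ofFn] at this
      exact this
  obtain ⟨hgm, hg⟩ := hg
  let F : Fin m ⊕ Fin t → Fin n' := Sum.elim e' (u' ∘ g)
  have hF : Function.Injective F := by
    have : F = Sum.elim e' u' ∘ Sum.map id g := by
      ext x; cases x <;> rfl
    rw [this]
    exact he'.comp (Function.injective_id.sumMap hgm.injective)
  have key : ∀ x y : Fin m ⊕ Fin t,
      (Sum.elim e u x < Sum.elim e u y ↔ F x < F y) ∧
      (π (Sum.elim e u x) < π (Sum.elim e u y) ↔ π' (F x) < π' (F y)) := by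
    have hlab : ∀ s i, (e s < u i ↔ e' s < u' (g i)) ∧
        (π (e s) < π (u i) ↔ π' (e' s) < π' (u' (g i))) := fun s i => by
      have := hg i
      simp only [pointLabel, Prod.mk.injEq] at this
      exact ⟨iff_of_eq (congrFun this.1 s), iff_of_eq (congrFun this.2 s)⟩
    rintro (s | i) (s' | j)
    · have := congrFun (congrFun hs s) s'
      simp only [skeleton, Prod.mk.injEq] at this
      exact ⟨iff_of_eq this.1, iff_of_eq this.2⟩
    · exact hlab s j
    · have h1 : e s' ≠ u i := fun h => by
        have := @he.1 (Sum.inl s') (Sum.inr i) h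
        simp at this
      have h2 : e' s' ≠ u' (g i) := fun h => by
        have := @hF (Sum.inl s') (Sum.inr i) h
        simp at this
      have aux : ∀ {N : ℕ} {x y : Fin N}, x ≠ y → (y < x ↔ ¬ x < y) := fun h => by
        rw [not_lt]; exact ⟨le_of_lt, fun h' => lt_of_le_of_ne h' h.symm⟩
      refine ⟨?_, ?_⟩
      · exact (aux h1).trans ((not_congr (hlab s' i).1).trans (aux h2).symm)
      · exact (aux (π.injective.ne h1)).trans
          ((not_congr (hlab s' i).2).trans (aux (π'.injective.ne h2)).symm)
    · exact ⟨hu.lt_iff_lt.trans (hu'.comp hgm).lt_iff_lt.symm,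
        hπu.lt_iff_lt.trans (hπu'.comp hgm).lt_iff_lt.symm⟩
  choose v hv using he.2
  refine contained_mk.2 ⟨OrderEmbedding.ofStrictMono (F ∘ v) fun i j hij => ?_, fun i j => ?_⟩
  · exact (key (v i) (v j)).1.1 (by rwa [hv, hv])
  · have := (key (v i) (v j)).2
    rwa [hv, hv] at this

/-- An antichain of permutations that are increasing up to `m` points is finite. -/
theorem finite_of_isAntichain_of_inc {B : Set Patt} (hB : IsAntichain Contained B) (m : ℕ)
    (h : ∀ b ∈ B, ∃ t, len b = t + m ∧ Contained (inc t) b) : B.Finite := by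
  have hw : B.PartiallyWellOrderedOn Contained := by
    have hd : ∀ b : B, ∃ (t : ℕ) (e : Fin m → Fin b.1.1) (u : Fin t → Fin b.1.1),
        StrictMono u ∧ StrictMono (b.1.2 ∘ u) ∧ Function.Bijective (Sum.elim e u) := by
      rintro ⟨⟨n, π⟩, hb⟩
      obtain ⟨t, hlen, f, hf⟩ := h _ hb
      change n = t + m at hlen
      replace hf : ∀ i j : Fin t, i < j ↔ π (f i) < π (f j) := hf
      have hc : (Finset.univ.map f.toEmbedding)ᶜ.card = m := by
        rw [Finset.card_compl, Finset.card_map, Finset.card_univ, Fintype.card_fin]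
        change n - Fintype.card (Fin t) = m
        rw [Fintype.card_fin, hlen]
        omega
      refine ⟨t, (Finset.univ.map f.toEmbedding)ᶜ.orderEmbOfFin hc, f, f.strictMono,
        fun i j hij => (hf i j).1 hij, ?_⟩
      rw [Fintype.bijective_iff_surjective_and_card]
      refine ⟨fun x => ?_, ?_⟩
      · by_cases hx : x ∈ Finset.univ.map f.toEmbedding
        · obtain ⟨i, -, hi⟩ := Finset.mem_map.1 hx
          exact ⟨Sum.inr i, hi⟩
        · have hx' : x ∈ Set.range ((Finset.univ.map f.toEmbedding)ᶜ.orderEmbOfFin hc) := by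
            rw [Finset.range_orderEmbOfFin]
            exact Finset.mem_coe.2 (Finset.mem_compl.2 hx)
          obtain ⟨i, hi⟩ := hx'
          exact ⟨Sum.inl i, hi⟩
      · rw [Fintype.card_sum, Fintype.card_fin, Fintype.card_fin, Fintype.card_fin]
        change m + t = n
        omega
    choose t e u hu hπu heu using hd
    have hwqo := (Finite.wellQuasiOrdered
      (α := Fin m → Fin m → Prop × Prop) (· = ·)).prod
      (wellQuasiOrdered_sublist (α := (Fin m → Prop) × (Fin m → Prop)))
    intro f
    obtain ⟨i, j, hij, h1, h2⟩ := hwqo fun i => (skeleton (f i).1.2 (e (f i)),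
      List.ofFn fun k => pointLabel (f i).1.2 (e (f i)) (u (f i) k))
    exact ⟨i, j, hij, contained_of_sublist_labels (hu _) (hπu _) (hu _) (hπu _) (heu _)
      (heu _).1 h1 h2⟩
  exact hB.finite_of_partiallyWellOrderedOn hw

/-- The basis is the set of minimal nonmembers. It is a finite union of antichains, one for each
exact number `m ≤ M` of points outside an increasing pattern. -/
theorem finitelyBased_of_inc {C : Set Patt} (hC : IsPermClass C) (M : ℕ)
    (h : ∀ b ∉ C, (∀ q, Contained q b → q ≠ b → q ∈ C) →
      ∃ t, len b ≤ t + M ∧ Contained (inc t) b) : FinitelyBased C := by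
  let B : Set Patt := {b | b ∉ C ∧ ∀ q, Contained q b → q ≠ b → q ∈ C}
  have hB : IsAntichain Contained B := fun a ha b hb hab hcon =>
    ha.1 (hb.2 a hcon hab)
  refine ⟨B, ?_, hB, ?_⟩
  · refine (Set.Finite.biUnion (Set.finite_Iic M) fun m _ =>
      finite_of_isAntichain_of_inc (B := {b ∈ B | ∃ t, len b = t + m ∧ Contained (inc t) b})
        (hB.subset (Set.sep_subset _ _)) m fun b hb => hb.2).subset fun b hb => ?_
    obtain ⟨t, ht, hc⟩ := h b hb.1 hb.2
    have hle := hc.len_le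
    rw [len_inc] at hle
    exact Set.mem_biUnion (x := len b - t) (Set.mem_Iic.2 (by omega)) ⟨hb, t, by omega, hc⟩
  · ext p
    refine ⟨fun hp b hb hbp => hb.1 (hC _ _ hbp hp), fun hp => ?_⟩
    by_contra hpC
    suffices ∀ n, ∀ q, len q = n → q ∉ C → ∃ b ∈ B, Contained b q by
      obtain ⟨b, hb, hbp⟩ := this _ p rfl hpC
      exact hp b hb hbp
    intro n
    induction n using Nat.strong_induction_on with
    | _ n ih =>
      intro q hq hqC
      by_cases hmin : ∀ r, Contained r q → r ≠ q → r ∈ C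
      · exact ⟨q, ⟨hqC, hmin⟩, .refl q⟩
      · push Not at hmin
        obtain ⟨r, hr, hne, hrC⟩ := hmin
        have hlt : len r < n := by
          by_contra hge
          exact hne (hr.eq_of_len_le (by omega))
        obtain ⟨b, hb, hbr⟩ := ih _ hlt r rfl hrC
        exact ⟨b, hb, hbr.trans hr⟩

/-! ### Inversion graphs and one-point deletions -/

/-- The inversion graph of a permutation. -/
def inversionGraph {n : ℕ} (π : Equiv.Perm (Fin n)) : SimpleGraph (Fin n) where
  Adj i j := (i < j ∧ π j < π i) ∨ (j < i ∧ π i < π j)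
  symm := ⟨fun _ _ h => h.symm⟩
  loopless := ⟨fun _ h => by rcases h with h | h <;> exact lt_irrefl _ h.1⟩

theorem inversionGraph_connected {n : ℕ} {π : Equiv.Perm (Fin (n + 1))}
    (h : SumIndecomposable ⟨n + 1, π⟩) : (inversionGraph π).Connected := by
  have key : ∀ m : ℕ, ∀ j : Fin (n + 1), (j : ℕ) = m → (inversionGraph π).Reachable 0 j := by
    intro m
    induction m using Nat.strong_induction_on with
    | _ m ih =>
      intro j hj
      rcases Nat.eq_zero_or_pos m with h0 | h0
      · obtain rfl : j = 0 := Fin.ext (by simp [hj, h0])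
        rfl
      obtain ⟨a, b, ha, hb, hab⟩ := exists_inversion_of_cut h h0 (hj ▸ j.2)
      have hra := ih a ha a rfl
      -- The inversion crossing the cut before `j` has `a < j ≤ b`. If `a` is not adjacent to `j`,
      -- then `π b < π a ≤ π j`, so `b` is `j` or adjacent to it.
      have haj : a < j := Fin.lt_def.2 (by omega)
      have hrb : (inversionGraph π).Reachable 0 b := hra.trans
        (SimpleGraph.Adj.reachable (Or.inl ⟨Fin.lt_def.2 (by omega), hab⟩))
      rcases lt_or_ge (π j) (π a) with hlt | hge
      · exact hra.trans (SimpleGraph.Adj.reachable (Or.inl ⟨haj, hlt⟩))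
      · rcases (show j ≤ b from Fin.le_def.2 (by omega)).eq_or_lt with rfl | hjb
        · exact hrb
        · exact hrb.trans (SimpleGraph.Adj.reachable (Or.inr ⟨hjb, hab.trans_le hge⟩))
  exact ⟨fun i j => (key _ i rfl).symm.trans (key _ j rfl)⟩

/-- A sum indecomposable permutation of length at least two has a sum indecomposable one point
deletion. -/
theorem SumIndecomposable.exists_delete {b : Patt} (hb : SumIndecomposable b) {n : ℕ}
    (hn : len b = n + 2) :
    ∃ q, Contained q b ∧ len q = n + 1 ∧ SumIndecomposable q := by
  obtain ⟨N, π⟩ := b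
  obtain rfl : N = n + 2 := hn
  obtain ⟨v, hv⟩ :=
    (inversionGraph_connected hb).exists_connected_induce_compl_singleton_of_finite_nontrivial
  obtain ⟨a, hac, ha⟩ := exists_pattern π v.succAbove (Fin.strictMono_succAbove v)
  refine ⟨_, hac, rfl, sumIndecomposable_of_forall_cut fun m h0 hm => ?_⟩
  let S : Set ({v}ᶜ : Set (Fin (n + 2))) :=
    {x | ∃ i : Fin (n + 1), (i : ℕ) < m ∧ v.succAbove i = x}
  let x : ({v}ᶜ : Set (Fin (n + 2))) := ⟨v.succAbove ⟨0, by omega⟩, v.succAbove_ne _⟩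
  let y : ({v}ᶜ : Set (Fin (n + 2))) := ⟨v.succAbove ⟨m, hm⟩, v.succAbove_ne _⟩
  have hy : y ∉ S := by
    rintro ⟨i, hi, he⟩
    have := Fin.succAbove_right_injective he
    rw [this] at hi
    exact lt_irrefl _ hi
  obtain ⟨w⟩ := hv.preconnected x y
  -- A walk in the graph without `v` from one side of the cut to the other uses an edge across it,
  -- which is the required inversion.
  obtain ⟨⟨⟨d, d'⟩, hadj⟩, -, ⟨i, hi, hid⟩, hd'⟩ := w.exists_boundary_dart S ⟨_, h0, rfl⟩ hy
  obtain ⟨j, hj⟩ := Fin.exists_succAbove_eq d'.2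
  have hmj : m ≤ j := by
    by_contra hlt
    exact hd' ⟨j, by omega, hj⟩
  refine ⟨i, j, hi, hmj, (ha j i).2 ?_⟩
  have hij : v.succAbove i < v.succAbove j :=
    Fin.strictMono_succAbove v (Fin.lt_def.2 (by omega))
  simp only [SimpleGraph.induce, SimpleGraph.comap_adj, inversionGraph] at hadj
  rcases hadj with h | h
  · rw [hj, hid]; exact h.2
  · rw [hj, hid] at hij
    exact absurd h.1 hij.asymm

/-- The sum closed class whose sum indecomposable members are those of `D`. -/
def sumClass (D : Set Patt) : Set Patt :=
  {p | ∀ q, Contained q p → 1 ≤ len q → SumIndecomposable q → q ∈ D}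

theorem isPermClass_sumClass (D : Set Patt) : IsPermClass (sumClass D) :=
  fun _ _ hpq hq r hr => hq r (hr.trans hpq)

theorem sumClosed_sumClass (D : Set Patt) : SumClosed (sumClass D) :=
  fun _ _ hp hq r hr hl hi => (hi.contained_dsum hr).elim (fun h => hp r h hl hi)
    fun h => hq r h hl hi

theorem mem_of_mem_sumClass {D : Set Patt} {p : Patt} (hp : p ∈ sumClass D) (hl : 1 ≤ len p)
    (hi : SumIndecomposable p) : p ∈ D :=
  hp p (.refl p) hl hi

/-- A minimal nonmember is itself an indecomposable outside `D`. If it has at least two points,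
deleting a suitable one gives an element of `D`, so the defect grows by at most one. -/
theorem finitelyBased_sumClass {D : Set Patt} (M : ℕ)
    (hD : ∀ p ∈ D, ∃ t, len p ≤ t + M ∧ Contained (inc t) p) :
    FinitelyBased (sumClass D) := by
  refine finitelyBased_of_inc (isPermClass_sumClass D) (M + 1) fun b hb hmin => ?_
  obtain ⟨q, hqb, hql, hqi, hqD⟩ : ∃ q, Contained q b ∧ 1 ≤ len q ∧ SumIndecomposable q ∧
      q ∉ D := by
    simpa [sumClass] using hb
  obtain rfl : q = b := by
    by_contra hne
    exact hqD (mem_of_mem_sumClass (hmin q hqb hne) hql hqi)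
  rcases hql.eq_or_lt with h1 | h1
  · exact ⟨0, by omega, ⟨(OrderEmbedding.ofIsEmpty : Fin 0 ↪o Fin q.1), fun i => i.elim0⟩⟩
  · obtain ⟨n, hn⟩ : ∃ n, len q = n + 2 := ⟨len q - 2, by omega⟩
    obtain ⟨r, hrq, hrl, hri⟩ := hqi.exists_delete hn
    have hrD : r ∈ D := mem_of_mem_sumClass (hmin r hrq (by rintro rfl; omega)) (by omega) hri
    obtain ⟨t, ht, hc⟩ := hD r hrD
    exact ⟨t, by omega, hc.trans hrq⟩

/-! ### The building blocks -/

/-- `(12⋯a ⊕ 21 ⊕ 12⋯k) ⊖ 1`. -/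
def hump (a k : ℕ) : Patt := skew (dsum (inc a) (dsum p21 (inc k))) (inc 1)

/-- `chain3` and `chain4` are `hump 1` and `hump 2` by definition; only the empty first summand
needs an argument. -/
theorem hump_zero (k : ℕ) : hump 0 k = chain2 k := by
  rw [hump, dsum_eq_right _ (len_inc 0), chain2]

/-- The permutation `312`. -/
def p312 : Patt := skew (inc 1) (inc 2)

/-- The permutation `3421`. -/
def p3421 : Patt := skew (skew (inc 2) (inc 1)) (inc 1)

/-- The permutation `4321`. -/
def p4321 : Patt := skew (skew p21 (inc 1)) (inc 1)

/-- The permutation `32541`. -/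
def p32541 : Patt := skew (dsum p21 p21) (inc 1)

/-- The sum indecomposables of a given length used in the construction, in order of priority. -/
def candidates : ℕ → List Patt
  | 0 => []
  | 1 => [chain1 0]
  | 2 => [chain1 1]
  | 3 => [chain1 2, hump 0 0, p312]
  | 4 => [chain1 3, hump 0 1, hump 1 0, p3421, p4321]
  | 5 => [chain1 4, hump 0 2, hump 1 1, hump 2 0, p32541]
  | 6 => [chain1 5, hump 0 3, hump 1 2, hump 2 1, hump 3 0]
  | k + 7 => [chain1 (k + 6), hump 0 (k + 4), hump 1 (k + 3), hump 2 (k + 2)]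

/-- The first `s n` candidates of each length `n`. -/
def selection (s : ℕ → ℕ) : Set Patt :=
  {p | ∃ r < s (len p), (candidates (len p))[r]? = some p}

@[simp] theorem len_p21 : len p21 = 2 := rfl

theorem oneLine_p21 : oneLine p21 = [2, 1] := by simp [p21, oneLine_skew, oneLine_inc]

@[simp] theorem len_chain1 (k : ℕ) : len (chain1 k) = k + 1 := rfl

@[simp] theorem len_hump (a k : ℕ) : len (hump a k) = a + k + 3 := by
  simp only [hump, len_skew, len_dsum, len_inc, len_p21]; omega

theorem chain1_mem_selection {s : ℕ → ℕ} {k : ℕ} (h : 1 ≤ s (k + 1)) :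
    chain1 k ∈ selection s := by
  refine ⟨0, h, ?_⟩
  rw [len_chain1]
  match k with
  | 0 | 1 | 2 | 3 | 4 | 5 | k + 6 => rfl

/-- The index of `hump a k` in its list is `a + 1`, independently of `k`. The bound on `a` is needed
because `hump 3 k` is listed only for `k = 0`. -/
theorem hump_mem_selection {s : ℕ → ℕ} {a k : ℕ} (ha : a ≤ 2) (h : a + 2 ≤ s (a + k + 3)) :
    hump a k ∈ selection s := by
  refine ⟨a + 1, by rw [len_hump]; omega, ?_⟩
  rw [len_hump]
  interval_cases a
  · rw [show 0 + k + 3 = k + 3 by omega]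
    match k with
    | 0 | 1 | 2 | 3 | k + 4 => rfl
  · rw [show 1 + k + 3 = k + 4 by omega]
    match k with
    | 0 | 1 | 2 | k + 3 => rfl
  · rw [show 2 + k + 3 = k + 5 by omega]
    match k with
    | 0 | 1 | k + 2 => rfl

theorem mem_candidates_cases {n r : ℕ} {p : Patt} (h : (candidates n)[r]? = some p) :
    (∃ k, p = chain1 k ∧ r = 0 ∧ n = k + 1) ∨
    (∃ a k, p = hump a k ∧ a ≤ 2 ∧ r = a + 1 ∧ n = a + k + 3) ∨
    (p = p312 ∧ r = 2 ∧ n = 3) ∨ (p = p3421 ∧ r = 3 ∧ n = 4) ∨ (p = p4321 ∧ r = 4 ∧ n = 4) ∨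
    (p = p32541 ∧ r = 4 ∧ n = 5) ∨ (p = hump 3 0 ∧ r = 4 ∧ n = 6) := by
  match n, r, h with
  | 1, 0, h | 2, 0, h | 3, 0, h | 4, 0, h | 5, 0, h | 6, 0, h | _ + 7, 0, h =>
    exact .inl ⟨_, (Option.some.inj h).symm, rfl, rfl⟩
  | 3, 1, h | 4, 1, h | 5, 1, h | 6, 1, h =>
    exact .inr (.inl ⟨0, _, (Option.some.inj h).symm, by omega, rfl, rfl⟩)
  | k + 7, 1, h => exact .inr (.inl ⟨0, _, (Option.some.inj h).symm, by omega, rfl, by omega⟩)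
  | 4, 2, h | 5, 2, h | 6, 2, h =>
    exact .inr (.inl ⟨1, _, (Option.some.inj h).symm, by omega, rfl, rfl⟩)
  | k + 7, 2, h => exact .inr (.inl ⟨1, _, (Option.some.inj h).symm, by omega, rfl, by omega⟩)
  | 5, 3, h | 6, 3, h =>
    exact .inr (.inl ⟨2, _, (Option.some.inj h).symm, by omega, rfl, rfl⟩)
  | k + 7, 3, h => exact .inr (.inl ⟨2, _, (Option.some.inj h).symm, by omega, rfl, by omega⟩)
  | 3, 2, h => exact .inr (.inr (.inl ⟨(Option.some.inj h).symm, rfl, rfl⟩))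
  | 4, 3, h => exact .inr (.inr (.inr (.inl ⟨(Option.some.inj h).symm, rfl, rfl⟩)))
  | 4, 4, h => exact .inr (.inr (.inr (.inr (.inl ⟨(Option.some.inj h).symm, rfl, rfl⟩))))
  | 5, 4, h =>
    exact .inr (.inr (.inr (.inr (.inr (.inl ⟨(Option.some.inj h).symm, rfl, rfl⟩)))))
  | 6, 4, h =>
    exact .inr (.inr (.inr (.inr (.inr (.inr ⟨(Option.some.inj h).symm, rfl, rfl⟩)))))

theorem mem_selection_cases {s : ℕ → ℕ} {p : Patt} (h : p ∈ selection s) :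
    (∃ k, p = chain1 k ∧ 1 ≤ s (k + 1)) ∨
    (∃ a k, p = hump a k ∧ a ≤ 2 ∧ a + 2 ≤ s (a + k + 3)) ∨
    (p = p312 ∧ 3 ≤ s 3) ∨ (p = p3421 ∧ 4 ≤ s 4) ∨ (p = p4321 ∧ 5 ≤ s 4) ∨
    (p = p32541 ∧ 5 ≤ s 5) ∨ (p = hump 3 0 ∧ 5 ≤ s 6) := by
  obtain ⟨r, hr, h⟩ := h
  rcases mem_candidates_cases h with ⟨k, h1, h2, h3⟩ | ⟨a, k, h1, h2, h3, h4⟩ | ⟨h1, h2, h3⟩ |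
      ⟨h1, h2, h3⟩ | ⟨h1, h2, h3⟩ | ⟨h1, h2, h3⟩ | ⟨h1, h2, h3⟩
  · rw [h3] at hr; exact .inl ⟨k, h1, by omega⟩
  · rw [h4] at hr; exact .inr (.inl ⟨a, k, h1, h2, by omega⟩)
  · rw [h3] at hr; exact .inr (.inr (.inl ⟨h1, by omega⟩))
  · rw [h3] at hr; exact .inr (.inr (.inr (.inl ⟨h1, by omega⟩)))
  · rw [h3] at hr; exact .inr (.inr (.inr (.inr (.inl ⟨h1, by omega⟩))))
  · rw [h3] at hr; exact .inr (.inr (.inr (.inr (.inr (.inl ⟨h1, by omega⟩)))))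
  · rw [h3] at hr; exact .inr (.inr (.inr (.inr (.inr (.inr ⟨h1, by omega⟩)))))

theorem inConstruction_of_mem_selection {s : ℕ → ℕ} {p : Patt} (h : p ∈ selection s) :
    InConstruction p := by
  rcases mem_selection_cases h with ⟨k, rfl, -⟩ | ⟨a, k, rfl, ha, -⟩ | ⟨rfl, -⟩ | ⟨rfl, -⟩ |
    ⟨rfl, -⟩ | ⟨rfl, -⟩ | ⟨rfl, -⟩
  · exact .inl ⟨k, .inl rfl⟩
  · refine .inl ⟨k, .inr ?_⟩
    interval_cases a
    · exact .inl (hump_zero k)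
    · exact .inr (.inl rfl)
    · exact .inr (.inr rfl)
  all_goals
    refine .inr ?_
    simp [Sporadic, p312, p3421, p4321, p32541, hump, oneLine_skew, oneLine_dsum, oneLine_p21,
      oneLine_inc, List.range']

theorem sumIndecomposable_of_mem_selection {s : ℕ → ℕ} {p : Patt} (h : p ∈ selection s) :
    SumIndecomposable p := by
  rcases mem_selection_cases h with ⟨k, rfl, -⟩ | ⟨a, k, rfl, ha, -⟩ | ⟨rfl, -⟩ | ⟨rfl, -⟩ |
    ⟨rfl, -⟩ | ⟨rfl, -⟩ | ⟨rfl, -⟩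
  · rcases Nat.eq_zero_or_pos k with rfl | hk
    · exact .of_len_le_one (by simp)
    · exact sumIndecomposable_skew hk (by simp)
  all_goals exact sumIndecomposable_skew (by simp; try omega) (by simp)

theorem exists_inc_contained_of_mem_selection {s : ℕ → ℕ} {p : Patt} (h : p ∈ selection s) :
    ∃ t, len p ≤ t + 6 ∧ Contained (inc t) p := by
  have short : ∀ {p : Patt}, len p ≤ 6 → ∃ t, len p ≤ t + 6 ∧ Contained (inc t) p :=
    fun {p} hp => ⟨0, by omega,
      ⟨(OrderEmbedding.ofIsEmpty : Fin 0 ↪o Fin p.1), fun i => i.elim0⟩⟩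
  rcases mem_selection_cases h with ⟨k, rfl, -⟩ | ⟨a, k, rfl, ha, -⟩ | ⟨rfl, -⟩ | ⟨rfl, -⟩ |
    ⟨rfl, -⟩ | ⟨rfl, -⟩ | ⟨rfl, -⟩
  · exact ⟨k, by simp, contained_skew_left _ _⟩
  -- Only `a + 3 ≤ 5` points lie outside the final `12⋯k`; the constant 6 comes from the sporadic
  -- permutation of length 6.
  · exact ⟨k, by rw [len_hump]; omega, ((contained_dsum_right _ _).trans
      (contained_dsum_right _ _)).trans (contained_skew_left _ _)⟩
  all_goals exact short (by simp [p312, p3421, p4321, p32541])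

/-! ### Counting -/

theorem len_of_mem_candidates {n : ℕ} {p : Patt} (h : p ∈ candidates n) : len p = n := by
  obtain ⟨r, h⟩ := List.mem_iff_getElem?.1 h
  rcases mem_candidates_cases h with ⟨k, rfl, h2, h3⟩ | ⟨a, k, rfl, h2, h3, h4⟩ | ⟨rfl, h2, h3⟩ |
      ⟨rfl, h2, h3⟩ | ⟨rfl, h2, h3⟩ | ⟨rfl, h2, h3⟩ | ⟨rfl, h2, h3⟩ <;>
  simp [p312, p3421, p4321, p32541, *]

theorem nodup_candidates (n : ℕ) : (candidates n).Nodup := by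
  match n with
  | 0 | 1 | 2 | 3 | 4 | 5 | 6 =>
    refine List.Nodup.of_map oneLine ?_
    simp [candidates, chain1, p312, p3421, p4321, p32541, hump, oneLine_skew, oneLine_dsum,
      oneLine_p21, oneLine_inc, List.range']
  | k + 7 =>
    -- The four chains begin 234, 324, 243 and 235, so three entries distinguish them.
    refine List.Nodup.of_map (fun p => (oneLine p).take 3) ?_
    simp [candidates, chain1, hump, oneLine_skew, oneLine_dsum, oneLine_p21, oneLine_inc,
      List.range']

theorem length_candidates {n : ℕ} (hn : 1 ≤ n) : (candidates n).length = bound n := by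
  match n with
  | 0 => omega
  | 1 | 2 | 3 | 4 | 5 | 6 => rfl
  | k + 7 =>
    simp [candidates, bound]

theorem ncard_selection {s : ℕ → ℕ} (hdom : DominatedBy s bound) {n : ℕ} (hn : 1 ≤ n) :
    {π : Equiv.Perm (Fin n) | (⟨n, π⟩ : Patt) ∈ selection s}.ncard = s n := by
  classical
  have hinj : Function.Injective (fun π : Equiv.Perm (Fin n) => (⟨n, π⟩ : Patt)) :=
    fun _ _ h => eq_of_heq (Sigma.mk.inj h).2
  have himg : (fun π : Equiv.Perm (Fin n) => (⟨n, π⟩ : Patt)) ''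
      {π | (⟨n, π⟩ : Patt) ∈ selection s} = ↑((candidates n).take (s n)).toFinset := by
    ext p
    simp only [Set.mem_image, List.coe_toFinset, Set.mem_ofPred_eq]
    constructor
    · rintro ⟨π, ⟨r, hr, h⟩, rfl⟩
      refine List.mem_iff_getElem?.2 ⟨r, ?_⟩
      rw [len_mk] at hr h
      rw [List.getElem?_take_of_lt hr]
      exact h
    · intro hp
      obtain rfl := len_of_mem_candidates (List.mem_of_mem_take hp)
      refine ⟨p.2, ?_, rfl⟩
      obtain ⟨r, hr⟩ := List.mem_iff_getElem?.1 hp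
      rw [List.getElem?_take] at hr
      split_ifs at hr with hrs
      exact ⟨r, hrs, hr⟩
  rw [← Set.ncard_image_of_injective _ hinj, himg, Set.ncard_coe_finset,
    List.toFinset_card_of_nodup ((nodup_candidates n).sublist (List.take_sublist _ _)),
    List.length_take, length_candidates hn, min_eq_left (hdom n hn)]

/-! ### Downward closure -/

/-- A sequence that has fallen to `c` or below at or after `m₀` stays there. -/
theorem le_of_threshold_step {s : ℕ → ℕ} {c m₀ : ℕ}
    (hstep : ∀ n, m₀ ≤ n → s n ≤ c → s (n + 1) ≤ c) {m n : ℕ} (hm : m₀ ≤ m) (hmn : m ≤ n)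
    (h : c + 1 ≤ s n) : c + 1 ≤ s m := by
  by_contra hc
  have : ∀ k, m ≤ k → s k ≤ c := fun k hk => by
    induction k, hk using Nat.le_induction with
    | base => omega
    | succ k hk ih => exact hstep k (hm.trans hk) ih
  have := this n hmn
  omega

/-- For `c = a + 1`, the lower limit `c + 2` on `m` is the length of `hump a 0`, so the range covers
every length at which `hump a` occurs. -/
theorem Legal.le_of_le {s : ℕ → ℕ} (hs : Legal s) {c m n : ℕ} (hc : c ≤ 3)
    (hm : c = 0 ∧ 1 ≤ m ∨ c + 2 ≤ m) (hmn : m ≤ n) (h : c + 1 ≤ s n) : c + 1 ≤ s m := by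
  interval_cases c
  · exact le_of_threshold_step (m₀ := 1) (fun n hn h => by have := hs.zero_step n hn; omega)
      (by omega) hmn h
  · exact le_of_threshold_step hs.one_step (by omega) hmn h
  · exact le_of_threshold_step hs.two_step (by omega) hmn h
  · exact le_of_threshold_step hs.three_step (by omega) hmn h

theorem eq_chain1_zero {p : Patt} (h : len p = 1) : p = chain1 0 := by
  obtain ⟨n, π⟩ := p
  obtain rfl : n = 1 := h
  exact Sigma.ext rfl (heq_of_eq (Subsingleton.elim _ _))

theorem SumIndecomposable.eq_chain1_one {p : Patt} (hp : SumIndecomposable p) (h : len p = 2) :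
    p = chain1 1 := by
  obtain ⟨n, π⟩ := p
  obtain rfl : n = 2 := h
  obtain ⟨i, j, hi, hj, hij⟩ := exists_inversion_of_cut hp one_pos one_lt_two
  obtain rfl : i = 0 := by omega
  obtain rfl : j = 1 := by omega
  refine Sigma.ext rfl (heq_of_eq (perm_ext_of_lt_iff fun i j => ?_))
  have key : ∀ i j : Fin 2, (skewPerm (Equiv.refl (Fin 1)) (Equiv.refl (Fin 1)) i <
      skewPerm (Equiv.refl (Fin 1)) (Equiv.refl (Fin 1)) j) ↔ j < i := by decide
  refine Iff.trans ?_ (key i j).symm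
  fin_cases i <;> fin_cases j <;> simp [hij, hij.le]

theorem mem_selection_of_len_le_two {s : ℕ → ℕ} (hs : Legal s) {p : Patt}
    (hp : SumIndecomposable p) (h1 : 1 ≤ len p) (h2 : len p ≤ 2) {n : ℕ} (hn : len p ≤ n)
    (h : 1 ≤ s n) : p ∈ selection s := by
  have h0 : 1 ≤ s (len p) := hs.le_of_le (c := 0) (by omega) (by omega) hn h
  obtain hl | hl : len p = 1 ∨ len p = 2 := by omega
  · rw [hl] at h0
    rw [eq_chain1_zero hl]
    exact chain1_mem_selection h0
  · rw [hl] at h0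
    rw [hp.eq_chain1_one hl]
    exact chain1_mem_selection h0

theorem Contained.eq_of_p21 {p : Patt} (h : Contained p p21) :
    p = inc 0 ∨ p = inc 1 ∨ p = p21 := by
  obtain ⟨a, b, ha, hb, rfl⟩ := h.exists_eq_skew
  obtain ⟨i, hi, rfl⟩ := ha.exists_eq_inc
  obtain ⟨j, hj, rfl⟩ := hb.exists_eq_inc
  interval_cases i <;> interval_cases j
  · exact .inl (skew_eq_left _ rfl)
  · exact .inr (.inl (skew_eq_right _ rfl))
  · exact .inr (.inl (skew_eq_left _ rfl))
  · exact .inr (.inr rfl)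

theorem SumIndecomposable.len_le_of_contained_inc {p : Patt} (hp : SumIndecomposable p) {k : ℕ}
    (h : Contained p (inc k)) : len p ≤ 1 := by
  obtain ⟨l, hl, rfl⟩ := h.exists_eq_inc
  by_contra hlt
  rw [len_inc] at hlt
  refine hp (inc 1) (inc (l - 1)) le_rfl (by rw [len_inc]; omega) ?_
  rw [dsum_inc_inc, show 1 + (l - 1) = l by omega]

theorem SumIndecomposable.len_le_of_contained_hump {p : Patt} (hp : SumIndecomposable p)
    {a k : ℕ} (h : Contained p (dsum (inc a) (dsum p21 (inc k)))) : len p ≤ 2 := by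
  rcases hp.contained_dsum h with h | h
  · exact (hp.len_le_of_contained_inc h).trans one_le_two
  rcases hp.contained_dsum h with h | h
  · exact h.len_le
  · exact (hp.len_le_of_contained_inc h).trans one_le_two

/-- A permutation contained in `p ⊖ 1` is contained in `p` or ends with its least entry. -/
theorem Contained.eq_of_skew_one {p q : Patt} (h : Contained q (skew p (inc 1))) :
    Contained q p ∨ ∃ p', Contained p' p ∧ q = skew p' (inc 1) := by
  obtain ⟨a, b, ha, hb, rfl⟩ := h.exists_eq_skew
  obtain ⟨j, hj, rfl⟩ := hb.exists_eq_inc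
  interval_cases j
  · left; rwa [skew_eq_left _ (len_inc 0)]
  · exact .inr ⟨a, ha, rfl⟩

theorem Contained.eq_of_hump_core {p : Patt} {a k : ℕ}
    (h : Contained p (dsum (inc a) (dsum p21 (inc k)))) :
    (∃ l < a + k + 2, p = inc l) ∨
      ∃ a' ≤ a, ∃ k' ≤ k, p = dsum (inc a') (dsum p21 (inc k')) := by
  obtain ⟨x, y, hx, hy, rfl⟩ := h.exists_eq_dsum
  obtain ⟨u, v, hu, hv, rfl⟩ := hy.exists_eq_dsum
  obtain ⟨a', ha, rfl⟩ := hx.exists_eq_inc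
  obtain ⟨k', hk, rfl⟩ := hv.exists_eq_inc
  rcases hu.eq_of_p21 with rfl | rfl | rfl
  · exact .inl ⟨a' + (0 + k'), by omega, by rw [dsum_inc_inc, dsum_inc_inc]⟩
  · exact .inl ⟨a' + (1 + k'), by omega, by rw [dsum_inc_inc, dsum_inc_inc]⟩
  · exact .inr ⟨a', ha, k', hk, rfl⟩

/-- A pattern that omits the final least entry lies in a sum of increasing pieces and 21, so it has
length at most 2. Otherwise the final 1 survives, and either 21 survives too (a hump) or the rest is
increasing (`chain1`). -/
theorem SumIndecomposable.cases_of_contained_hump {q : Patt} (hq : SumIndecomposable q)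
    {a k : ℕ} (h : Contained q (hump a k)) :
    len q ≤ 2 ∨ (∃ l < a + k + 2, q = chain1 l) ∨ ∃ a' ≤ a, ∃ k' ≤ k, q = hump a' k' := by
  rcases h.eq_of_skew_one with h | ⟨p', hp', rfl⟩
  · exact .inl (hq.len_le_of_contained_hump h)
  rcases hp'.eq_of_hump_core with ⟨l, hl, rfl⟩ | ⟨a', ha, k', hk, rfl⟩
  · exact .inr (.inl ⟨l, hl, rfl⟩)
  · exact .inr (.inr ⟨a', ha, k', hk, rfl⟩)

theorem skew_p21_one : skew p21 (inc 1) = hump 0 0 :=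
  oneLine_injective (by simp [hump, oneLine_skew, oneLine_dsum, oneLine_p21, oneLine_inc])

/-- Each indecomposable pattern of length at least 3 properly contained in a selected permutation
has an index no larger than that permutation's own, so `Legal.le_of_le` shows that it was selected.
-/
theorem selection_downward {s : ℕ → ℕ} (hs : Legal s) {p q : Patt} (hp : p ∈ selection s)
    (hqp : Contained q p) (hq1 : 1 ≤ len q) (hq : SumIndecomposable q) : q ∈ selection s := by
  rcases hqp.len_le.eq_or_lt with heq | hlt
  · rwa [hqp.eq_of_len_le heq.ge]
  have hlen : 1 ≤ s (len p) := by
    obtain ⟨r, hr, -⟩ := hp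
    omega
  by_cases h2 : len q ≤ 2
  · exact mem_selection_of_len_le_two hs hq hq1 h2 hqp.len_le hlen
  have hc1 : ∀ k, k + 1 ≤ len p → chain1 k ∈ selection s := fun k hk =>
    chain1_mem_selection (hs.le_of_le (c := 0) (by omega) (by omega) hk hlen)
  have hh : ∀ {a k n : ℕ}, a ≤ 2 → a + k + 3 ≤ n → a + 2 ≤ s n → hump a k ∈ selection s :=
    fun {a k n} ha hk hn =>
      hump_mem_selection ha (hs.le_of_le (c := a + 1) (by omega) (by omega) hk hn)
  rcases mem_selection_cases hp with ⟨k, rfl, h⟩ | ⟨a, k, rfl, ha, h⟩ | ⟨rfl, h⟩ | ⟨rfl, h⟩ |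
    ⟨rfl, h⟩ | ⟨rfl, h⟩ | ⟨rfl, h⟩
  · rcases hqp.eq_of_skew_one with h' | ⟨p', hp', rfl⟩
    · have := hq.len_le_of_contained_inc h'
      omega
    · obtain ⟨l, hl, rfl⟩ := hp'.exists_eq_inc
      exact hc1 l (by rw [len_chain1]; omega)
  · rcases hq.cases_of_contained_hump hqp with h' | ⟨l, hl, rfl⟩ | ⟨a', ha', k', hk', rfl⟩
    · omega
    · exact hc1 l (by rw [len_hump]; omega)
    · exact hh (n := a + k + 3) (by omega) (by omega) (by omega)
  · simp only [p312, len_skew, len_inc] at hlt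
    omega
  -- For 3421, the proper indecomposable patterns of length 3 are 231 and 321.
  · have h21 : hump 0 0 ∈ selection s := hh (n := 4) (by omega) (by omega) (by omega)
    have h231 : chain1 2 ∈ selection s := hc1 2 (by simp [p3421])
    simp only [p3421, len_skew, len_inc] at hlt
    rcases hqp.eq_of_skew_one with h' | ⟨p', hp', rfl⟩
    · rwa [show q = chain1 2 from h'.eq_of_len_le (by simp only [len_skew, len_inc]; omega)]
    · simp only [len_skew, len_inc] at hlt h2
      rcases hp'.eq_of_skew_one with h' | ⟨p'', hp'', rfl⟩
      · rw [h'.eq_of_len_le (by rw [len_inc]; omega)]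
        exact h231
      · simp only [len_skew, len_inc] at hlt h2
        obtain ⟨l, hl, rfl⟩ := hp''.exists_eq_inc
        rw [len_inc] at hlt h2
        obtain rfl : l = 1 := by omega
        rwa [← skew_p21_one] at h21
  · have h21 : hump 0 0 ∈ selection s := hh (n := 4) (by omega) (by omega) (by omega)
    simp only [p4321, len_skew, len_inc, len_p21] at hlt
    rcases hqp.eq_of_skew_one with h' | ⟨p', hp', rfl⟩
    · rwa [h'.eq_of_len_le (by simp only [len_skew, len_inc, len_p21]; omega), skew_p21_one]
    · simp only [len_skew, len_inc] at hlt h2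
      rcases hp'.eq_of_skew_one with h' | ⟨p'', hp'', rfl⟩
      · rwa [h'.eq_of_len_le (by rw [len_p21]; omega), skew_p21_one]
      · simp only [len_skew, len_inc] at hlt h2
        rcases hp''.eq_of_p21 with rfl | rfl | rfl
        · rw [len_inc] at h2; omega
        · rwa [← skew_p21_one] at h21
        · rw [len_p21] at hlt; omega
  -- For 32541, the proper indecomposable patterns of length at least 3 are 231, 321, 3241 and 2431.
  · have h1 : chain1 2 ∈ selection s := hc1 2 (by simp [p32541])
    have h2' : hump 0 0 ∈ selection s := hh (n := 5) (by omega) (by omega) (by omega)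
    have h3 : hump 0 1 ∈ selection s := hh (n := 5) (by omega) (by omega) (by omega)
    have h4 : hump 1 0 ∈ selection s := hh (n := 5) (by omega) (by omega) (by omega)
    rcases hqp.eq_of_skew_one with h' | ⟨p', hp', rfl⟩
    · rcases hq.contained_dsum h' with h'' | h'' <;>
      · have := h''.len_le
        rw [len_p21] at this
        omega
    · obtain ⟨x, y, hx, hy, rfl⟩ := hp'.exists_eq_dsum
      rcases hx.eq_of_p21 with rfl | rfl | rfl <;> rcases hy.eq_of_p21 with rfl | rfl | rfl
      · simp at h2
      · simp at h2
      · rwa [dsum_eq_right _ (len_inc 0), skew_p21_one]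
      · simp at h2
      · rwa [dsum_inc_inc]
      · rwa [hump, dsum_eq_left p21 (len_inc 0)] at h4
      · rwa [dsum_eq_left _ (len_inc 0), skew_p21_one]
      · rwa [hump, dsum_eq_right _ (len_inc 0)] at h3
      · simp [p32541] at hlt
  · rw [len_hump] at hlt
    rcases hq.cases_of_contained_hump hqp with h' | ⟨l, hl, rfl⟩ | ⟨a', ha', k', hk', rfl⟩
    · omega
    · exact hc1 l (by rw [len_hump]; omega)
    -- The length is below 6, so `a' ≤ 2` and the pattern lies in one of the infinite chains.
    · rw [len_hump] at hlt
      exact hh (n := 6) (by omega) (by omega) (by omega)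

end PermClass

/-! ### The realizing class -/

theorem mainTheorem9 (s : ℕ → ℕ) (hlegal : PermClass.Legal s)
    (hdom : PermClass.DominatedBy s PermClass.bound) :
    PermClass.Realizable s ∧
    ∃ C : Set PermClass.Patt,
      PermClass.IsPermClass C ∧
      PermClass.FinitelyBased C ∧
      PermClass.SumClosed C ∧
      PermClass.Realizes C s ∧
      ∀ p ∈ C, 1 ≤ PermClass.len p → PermClass.SumIndecomposable p →
        PermClass.InConstruction p := by
  open PermClass in
  have hreal : Realizes (sumClass (selection s)) s := fun n hn => by
    rw [← ncard_selection hdom hn]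
    congr 1
    ext π
    exact ⟨fun h => mem_of_mem_sumClass h.2 hn h.1, fun h =>
      ⟨sumIndecomposable_of_mem_selection h, fun q hq h1 hi =>
        selection_downward hlegal h hq h1 hi⟩⟩
  open PermClass in
  exact ⟨⟨_, isPermClass_sumClass _, hreal⟩, _, isPermClass_sumClass _,
    finitelyBased_sumClass 6 fun p hp => exists_inc_contained_of_mem_selection hp,
    sumClosed_sumClass _, hreal, fun p hp hl hi =>
      inConstruction_of_mem_selection (mem_of_mem_sumClass hp hl hi)⟩
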